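/- Let $A$ be a finite alphabet and let $Y\subseteq A^{\mathbb Z}$ be a shift space (a closed shift-invariant set). For a probability measure $\mu$ on $Y$ and a word $w\in A^*$, write $\hat\mu(w)=\mu(\{x\in Y : x_0x_1\cdots x_{|w|-1}=w\})$. A probability measure is called *$1$-step Markov* if there are a finite set $B$ of symbols, an irreducible stochastic $B\times B$-matrix $M$ and a stochastic row vector $v$ with $vM=v$ such that it is the probability measure on $B^{\mathbb Z}$ with $\hat\mu(b_1\cdots b_m)=v_{b_1}M_{b_1,b_2}\cdots M_{b_{m-1},b_m}$ for all $m\ge 1$ and $b_1,\dots,b_m\in B$; it is regarded as a measure on every shift space that carries it, over any alphabet containing $B$. For $k\ge 1$, $\mu$ is *$k$-step Markov* if its image under the higher block code $x\mapsto (x_{i-k+1}\cdots x_i)_{i\in\mathbb Z}$, whose symbols are words of length $k$, is $1$-step Markov. A probability measure on $Y$ is *sofic* if it is the image, under a factor map (a surjective sliding block code) $X\to Y$ from a shift of finite type $X$, of a $1$-step Markov measure on $X$. A *linear representation of dimension $n$* of $\mu$ consists of a row vector $\lambda\in\mathbb R^n$, a monoid morphism $\varphi$ from $A^*$ to the $n\times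 n$ real matrices and a column vector $\gamma\in\mathbb R^n$ with $\hat\mu(w)=\lambda\varphi(w)\gamma$ for all $w\in A^*$. It is *minimal* (or *reduced*) if the vectors $\lambda\varphi(w)$, $w\in A^*$, span $\mathbb R^n$ and the vectors $\varphi(w)\gamma$, $w\in A^*$, span $\mathbb R^n$. **Theorem.** Let $\mu$ be an invariant sofic measure on $Y$, let $n$ be the dimension of its minimal linear representation, and set $K=2^{n^2-1}$. If $\mu$ is not $K$-step Markov, then $\mu$ is not $k$-step Markov for any $k\ge 1$. -/

import Mathlib

open MeasureTheory

namespace SymbolicDynamics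

/-- The shift transformation on two-sided sequences: `(S x) i = x (i + 1)`. -/
def shift {A : Type*} (x : ℤ → A) : ℤ → A := fun i => x (i + 1)

/-- A shift space over `A`: a closed shift-invariant set of two-sided sequences. -/
structure IsShiftSpace {A : Type*} [TopologicalSpace A] (X : Set (ℤ → A)) : Prop where
  isClosed : IsClosed X
  preimage_shift : shift ⁻¹' X = X

/-- The word `w` occurs in `x` at position `i`. -/
def OccursAt {A : Type*} (w : List A) (x : ℤ → A) (i : ℤ) : Prop :=
  ∀ j : Fin w.length, x (i + (j : ℤ)) = w.get j

/-- A shift of finite type: all sequences without any factor in some finite set of words.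
Such a set is automatically closed and shift-invariant. -/
def IsShiftOfFiniteType {A : Type*} (X : Set (ℤ → A)) : Prop :=
  ∃ F : Set (List A), F.Finite ∧ X = {x | ∀ w ∈ F, ∀ i : ℤ, ¬ OccursAt w x i}

/-- The cylinder of the word `w`: the sequences `x` with `x_{[0,|w|)} = w`. -/
def wordCylinder {A : Type*} (w : List A) : Set (ℤ → A) := {x | OccursAt w x 0}

/-- The sliding block code with memory `m` and anticipation `n` defined by the block map `f`:
`φ(x)_i = f (x_{i-m} ⋯ x_{i+n})`. -/
def slidingBlockCode {A B : Type*} (m n : ℕ) (f : (Fin (m + n + 1) → A) → B)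
    (x : ℤ → A) : ℤ → B :=
  fun i => f fun j => x (i - m + (j : ℤ))

/-- `φ` is a factor map from `X` onto `Y`: on `X` it is given by a sliding block code, and
its image is `Y`. -/
def IsFactorMap {A B : Type*} (X : Set (ℤ → A)) (Y : Set (ℤ → B))
    (φ : (ℤ → A) → ℤ → B) : Prop :=
  (∃ (m n : ℕ) (f : (Fin (m + n + 1) → A) → B), φ = slidingBlockCode m n f) ∧ φ '' X = Y

/-- The higher block code `γ_k`, the symbols of the target being the words of length `k`
themselves: `γ_k(x)_i = x_{i-k+1} ⋯ x_i`. -/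
def higherBlockCode {A : Type*} (k : ℕ) (x : ℤ → A) : ℤ → (Fin k → A) :=
  fun i j => x (i - k + 1 + (j : ℤ))

/-- A probability measure on the shift space `X`, seen as a Borel probability measure on the
space of all two-sided sequences which is carried by `X`. -/
structure IsProbabilityMeasureOn {A : Type*} [MeasurableSpace A]
    (X : Set (ℤ → A)) (μ : Measure (ℤ → A)) : Prop where
  isProbabilityMeasure : IsProbabilityMeasure μ
  compl_eq_zero : μ Xᶜ = 0

/-- `μ(S⁻¹ U) = μ(U)` for every Borel set `U`. -/
def IsInvariant {A : Type*} [MeasurableSpace A] (μ : Measure (ℤ → A)) : Prop :=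
  ∀ U : Set (ℤ → A), MeasurableSet U → μ (shift ⁻¹' U) = μ U

/-- `1`-step Markov measures: there are a set `s` of symbols, an irreducible stochastic
`s × s`-matrix `M` and a stochastic row vector `v` with `v M = v`, such that `μ` is the
probability measure on `s^ℤ` with
`μ [a₀ a₁ ⋯ aₙ] = v a₀ * M a₀ a₁ * ⋯ * M aₙ₋₁ aₙ` for all symbols `aᵢ ∈ s`.
(These cylinders carry the total mass `1`, so cylinders of words using a symbol outside `s`
are null.) -/
def IsOneStepMarkov {A : Type*} [MeasurableSpace A] (μ : Measure (ℤ → A)) : Prop :=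
  IsProbabilityMeasure μ ∧
    ∃ (s : Finset A) (v : s → ℝ) (M : Matrix s s ℝ),
      ((∀ a b, 0 ≤ M a b) ∧ ∀ a, ∑ b, M a b = 1) ∧
      M.IsIrreducible ∧
      ((∀ a, 0 ≤ v a) ∧ ∑ a, v a = 1) ∧
      Matrix.vecMul v M = v ∧
      ∀ (n : ℕ) (w : Fin (n + 1) → s),
        μ.real (wordCylinder (List.ofFn fun i => (w i : A))) =
          v (w 0) * ∏ i : Fin n, M (w i.castSucc) (w i.succ)

/-- `μ` is `k`-step Markov if its image under the higher block code `γ_k` is a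
`1`-step Markov measure. -/
def IsStepMarkov {A : Type*} [MeasurableSpace A] (k : ℕ) (μ : Measure (ℤ → A)) : Prop :=
  IsOneStepMarkov (μ.map (higherBlockCode k))

/-- A measure on `Y` is sofic if it is the image, under a factor map `φ : X → Y` from a shift
of finite type `X`, of a `1`-step Markov measure on `X`. Up to renaming symbols, the finite
alphabet of `X` is some `Fin m`. -/
def IsSofic {A : Type*} [MeasurableSpace A] (Y : Set (ℤ → A)) (μ : Measure (ℤ → A)) : Prop :=
  ∃ (m : ℕ) (X : Set (ℤ → Fin m)) (φ : (ℤ → Fin m) → ℤ → A) (ν : Measure (ℤ → Fin m)),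
    IsShiftOfFiniteType X ∧ IsFactorMap X Y φ ∧
      IsProbabilityMeasureOn X ν ∧ IsOneStepMarkov ν ∧ μ = ν.map φ

/-- A triple `(λ, φ, γ)` of dimension `n`: a row vector, a monoid morphism from words to
`n × n` real matrices, and a column vector. -/
structure LinearRepresentation (A : Type*) (n : ℕ) where
  row : Fin n → ℝ
  mor : FreeMonoid A →* Matrix (Fin n) (Fin n) ℝ
  col : Fin n → ℝ

namespace LinearRepresentation

variable {A : Type*} {n : ℕ}

/-- The map `w ↦ λ φ(w) γ` defined by the triple. -/
def series (R : LinearRepresentation A n) (w : FreeMonoid A) : ℝ :=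
  Matrix.vecMul R.row (R.mor w) ⬝ᵥ R.col

/-- The triple represents `μ`: `λ φ(w) γ = μ [w]` for every word `w`. -/
def Represents [MeasurableSpace A] (R : LinearRepresentation A n)
    (μ : Measure (ℤ → A)) : Prop :=
  ∀ w : FreeMonoid A, R.series w = μ.real (wordCylinder w.toList)

/-- A representation is reduced (i.e. minimal) if the vectors `λ φ(w)` generate `ℝⁿ` and the
vectors `φ(w) γ` generate `ℝⁿ`. -/
def IsReduced (R : LinearRepresentation A n) : Prop :=
  Submodule.span ℝ (Set.range fun w => Matrix.vecMul R.row (R.mor w)) = ⊤ ∧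
    Submodule.span ℝ (Set.range fun w => Matrix.mulVec (R.mor w) R.col) = ⊤

end LinearRepresentation

end SymbolicDynamics

/-! For invariant `μ`, being `k`-step Markov means two things: the splitting `μ(wuv) μ(u) = μ(wu)
μ(uv)` for all `w`, `v` and all `|u| = k`, and the connectedness of words of length `k` of positive
measure (`isStepMarkov_iff`). In a reduced representation, splitting at `u` makes `φ(u)` a matrix of
rank at most `1` (`Represents.annihilatesSkew`); conversely rank at most `1` gives splitting
(`Represents.split_of_annihilatesSkew`). Rank at most `1` is a linear condition for the congruence
action `X ↦ φ(u) X φ(u)ᵀ`: it kills every skew-symmetric `X`. A dimension count then shows that if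
all words of some length `k` kill the skew-symmetric matrices, so do all words of length at least
`n²` (`annihilatesSkew_of_sq_le_length`), and `2^(n²-1) ≥ n²`. Connectedness passes from order `k`
to any order that splits (`IsMarkovOfOrder.of_split`). -/

namespace SymbolicDynamics

/-! ### Probabilities of finite windows and their marginals. -/

section Window

variable {A : Type*}

/-- The sequences which agree with `z` on the interval `[a, b)`. -/
def window (z : ℕ → A) (a b : ℕ) : Set (ℤ → A) :=
  {x | ∀ i : ℕ, a ≤ i → i < b → x i = z i}

lemma window_congr {z z' : ℕ → A} {a b : ℕ} (h : ∀ i, a ≤ i → i < b → z i = z' i) :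
    window z a b = window z' a b := by
  ext x
  simp only [window, Set.mem_ofPred_eq]
  exact forall_congr' fun i => forall_congr' fun ha => forall_congr' fun hb => by rw [h i ha hb]

lemma window_mono (z : ℕ → A) {a b a' b' : ℕ} (ha : a ≤ a') (hb : b' ≤ b) :
    window z a b ⊆ window z a' b' :=
  fun _ hx i h1 h2 => hx i (ha.trans h1) (h2.trans_le hb)

lemma window_self (z : ℕ → A) (a : ℕ) : window z a a = Set.univ :=
  Set.eq_univ_of_forall fun _ _ h1 h2 => absurd h1 h2.not_ge

lemma window_succ_right (z : ℕ → A) {a b : ℕ} (h : a ≤ b) :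
    window z a (b + 1) = window z a b ∩ {x | x b = z b} := by
  ext x
  constructor
  · exact fun hx => ⟨fun i h1 h2 => hx i h1 (by omega), hx b h (by omega)⟩
  · rintro ⟨h1, h2⟩ i hi hi'
    rcases Nat.lt_succ_iff_lt_or_eq.1 hi' with h3 | rfl
    exacts [h1 i hi h3, h2]

lemma window_succ_left (z : ℕ → A) {a b : ℕ} (h : a < b) :
    window z a b = window z (a + 1) b ∩ {x | x a = z a} := by
  ext x
  constructor
  · exact fun hx => ⟨fun i h1 h2 => hx i (by omega) h2, hx a le_rfl h⟩
  · rintro ⟨h1, h2⟩ i hi hi'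
    rcases hi.eq_or_lt with rfl | h3
    exacts [h2, h1 i h3 hi']

lemma preimage_shift_window (z : ℕ → A) (a b : ℕ) :
    shift ⁻¹' window (fun i => z (i + 1)) a b = window z (a + 1) (b + 1) := by
  ext x
  simp only [window, shift, Set.mem_preimage, Set.mem_ofPred_eq]
  constructor
  · intro h i h1 h2
    obtain ⟨j, rfl⟩ : ∃ j, i = j + 1 := ⟨i - 1, by omega⟩
    exact_mod_cast h j (by omega) (by omega)
  · intro h i h1 h2
    exact_mod_cast h (i + 1) (by omega) (by omega)

lemma wordCylinder_eq_window (l : List A) (z : ℕ → A)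
    (h : ∀ (j : ℕ) (hj : j < l.length), z j = l[j]) :
    wordCylinder l = window z 0 l.length := by
  ext x
  simp only [wordCylinder, OccursAt, window, Set.mem_ofPred_eq, zero_add, List.get_eq_getElem]
  constructor
  · intro hx i _ hi
    rw [h i hi]
    exact hx ⟨i, hi⟩
  · intro hx j
    rw [← h j j.2]
    exact hx j (Nat.zero_le _) j.2

lemma setOf_apply_eq (i : ℤ) (c : A) :
    {x : ℤ → A | x i = c} = (fun x : ℤ → A => x i) ⁻¹' {c} := by
  ext x
  simp

variable [MeasurableSpace A]

/-- The measure of the set of sequences which agree with `z` on `[a, b)`. -/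
noncomputable def windowProb (μ : Measure (ℤ → A)) (z : ℕ → A) (a b : ℕ) : ℝ :=
  μ.real (window z a b)

lemma windowProb_nonneg (μ : Measure (ℤ → A)) (z : ℕ → A) (a b : ℕ) : 0 ≤ windowProb μ z a b :=
  measureReal_nonneg

lemma windowProb_congr (μ : Measure (ℤ → A)) {z z' : ℕ → A} {a b : ℕ}
    (h : ∀ i, a ≤ i → i < b → z i = z' i) : windowProb μ z a b = windowProb μ z' a b := by
  rw [windowProb, windowProb, window_congr h]

variable (μ : Measure (ℤ → A)) [IsProbabilityMeasure μ]

lemma windowProb_mono (z : ℕ → A) {a b a' b' : ℕ} (ha : a ≤ a') (hb : b' ≤ b) :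
    windowProb μ z a b ≤ windowProb μ z a' b' :=
  measureReal_mono (window_mono z ha hb)

lemma windowProb_self (z : ℕ → A) (a : ℕ) : windowProb μ z a a = 1 := by
  simp [windowProb, window_self]

variable [MeasurableSingletonClass A]

lemma measurableSet_apply_eq (i : ℤ) (c : A) : MeasurableSet {x : ℤ → A | x i = c} := by
  rw [setOf_apply_eq]
  exact measurable_pi_apply i (measurableSet_singleton c)

lemma measurableSet_window (z : ℕ → A) (a b : ℕ) : MeasurableSet (window z a b) := by
  have : window z a b = ⋂ i : ℕ, ⋂ _ : a ≤ i, ⋂ _ : i < b, {x : ℤ → A | x i = z i} := by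
    ext x
    simp [window]
  rw [this]
  exact MeasurableSet.iInter fun i => MeasurableSet.iInter fun _ => MeasurableSet.iInter fun _ =>
    measurableSet_apply_eq _ _

lemma IsInvariant.windowProb_add {μ : Measure (ℤ → A)} (hμ : IsInvariant μ) (z : ℕ → A)
    (a b c : ℕ) : windowProb μ (fun i => z (i + c)) a b = windowProb μ z (a + c) (b + c) := by
  induction c generalizing z with
  | zero => rfl
  | succ c ih =>
    have h := ih (fun i => z (i + 1))
    simp only [add_assoc] at h
    rw [h, windowProb, windowProb, measureReal_def, measureReal_def, ← add_assoc, ← add_assoc,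
      ← preimage_shift_window, hμ _ (measurableSet_window _ _ _)]

/-- Equality of lengths is written additively, which avoids truncated subtraction and also covers
empty windows. -/
lemma IsInvariant.windowProb_eq {μ : Measure (ℤ → A)} (hμ : IsInvariant μ) {z z' : ℕ → A}
    {a b a' b' : ℕ} (hab : a + b' = a' + b) (h : ∀ i, a + i < b → z (a + i) = z' (a' + i)) :
    windowProb μ z a b = windowProb μ z' a' b' := by
  rcases le_total b a with hba | hba
  · have e1 : window z a b = Set.univ :=
      Set.eq_univ_of_forall fun _ i h1 h2 => absurd (h1.trans_lt h2) hba.not_gt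
    have e2 : window z' a' b' = Set.univ :=
      Set.eq_univ_of_forall fun _ i h1 h2 => absurd (h1.trans_lt h2) (by omega)
    rw [windowProb, windowProb, e1, e2]
  obtain ⟨n, rfl⟩ := Nat.exists_eq_add_of_le hba
  obtain rfl : b' = a' + n := by omega
  have h1 := hμ.windowProb_add z 0 n a
  have h2 := hμ.windowProb_add z' 0 n a'
  rw [zero_add, add_comm n] at h1 h2
  rw [← h1, ← h2]
  refine windowProb_congr μ fun i _ hi => ?_
  rw [add_comm i a, add_comm i a']
  exact h i (by omega)

lemma sum_measureReal_inter_apply_eq [Fintype A] (U : Set (ℤ → A)) (i : ℤ) :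
    ∑ c, μ.real (U ∩ {x | x i = c}) = μ.real U := by
  have h := sum_measureReal_preimage_singleton (μ := μ.restrict U) (Finset.univ : Finset A)
    (f := fun x : ℤ → A => x i) (fun c _ => measurable_pi_apply i (measurableSet_singleton c))
  simp only [Finset.coe_univ, Set.preimage_univ, measureReal_restrict_apply MeasurableSet.univ,
    Set.univ_inter] at h
  rw [← h]
  refine Finset.sum_congr rfl fun c _ => ?_
  rw [← setOf_apply_eq, measureReal_restrict_apply (measurableSet_apply_eq i c), Set.inter_comm]

lemma sum_windowProb_update_right [Fintype A] (z : ℕ → A) {a b : ℕ} (h : a ≤ b) :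
    ∑ c, windowProb μ (Function.update z b c) a (b + 1) = windowProb μ z a b := by
  rw [windowProb, ← sum_measureReal_inter_apply_eq μ _ b]
  refine Finset.sum_congr rfl fun c _ => ?_
  rw [windowProb, window_succ_right _ h, Function.update_self]
  congr 2
  exact window_congr fun i _ hi => Function.update_of_ne hi.ne _ _

lemma sum_windowProb_update_left [Fintype A] (z : ℕ → A) {a b : ℕ} (h : a < b) :
    ∑ c, windowProb μ (Function.update z a c) a b = windowProb μ z (a + 1) b := by
  rw [windowProb, ← sum_measureReal_inter_apply_eq μ _ a]
  refine Finset.sum_congr rfl fun c _ => ?_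
  rw [windowProb, window_succ_left _ h, Function.update_self]
  congr 2
  exact window_congr fun i hi _ => Function.update_of_ne (by omega) _ _

end Window


/-- An entry of `M ^ k` is a sum of nonnegative path weights. This turns matrix irreducibility into
a statement about words. -/
lemma pow_apply_pos_iff_exists_path {ι : Type*} [Fintype ι] [DecidableEq ι] {M : Matrix ι ι ℝ}
    (hM : ∀ i j, 0 ≤ M i j) (k : ℕ) (i j : ι) :
    0 < (M ^ k) i j ↔
      ∃ y : ℕ → ι, y 0 = i ∧ y k = j ∧ ∀ t < k, 0 < M (y t) (y (t + 1)) := by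
  induction k generalizing j with
  | zero =>
    constructor
    · intro h
      refine ⟨fun _ => i, rfl, ?_, by simp⟩
      by_contra hij
      simp [Matrix.one_apply_ne hij] at h
    · rintro ⟨y, rfl, rfl, -⟩
      simp
  | succ k ih =>
    have hpow : ∀ l, 0 ≤ (M ^ k) i l := fun l => Matrix.pow_apply_nonneg hM k i l
    rw [pow_succ, Matrix.mul_apply,
      Finset.sum_pos_iff_of_nonneg fun l _ => mul_nonneg (hpow l) (hM l j)]
    constructor
    · rintro ⟨l, -, hl⟩
      have h1 : 0 < (M ^ k) i l := (hpow l).lt_of_ne fun h => by simp [← h] at hl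
      have h2 : 0 < M l j := (hM l j).lt_of_ne fun h => by simp [← h] at hl
      obtain ⟨y, h0, hk, hy⟩ := (ih l).1 h1
      refine ⟨fun t => if t ≤ k then y t else j, by simpa using h0, by simp, fun t ht => ?_⟩
      rcases Nat.lt_succ_iff_lt_or_eq.1 ht with h | rfl
      · simpa [h.le, Nat.succ_le_iff.2 h] using hy t h
      · simpa [hk] using h2
    · rintro ⟨y, h0, rfl, hy⟩
      exact ⟨y k, Finset.mem_univ _, mul_pos
        ((ih (y k)).2 ⟨y, h0, rfl, fun t ht => hy t (ht.trans k.lt_succ_self)⟩)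
        (hy k k.lt_succ_self)⟩

/-! ### Order one: matrices versus splitting and connectedness. -/

section Markov

variable {A : Type*} [MeasurableSpace A]

/-- A word-level description of the irreducible Markov measures with memory `k`: given a word of
length `k`, the past and the future are independent, and any two words of length `k` with positive
probability are joined by a word with positive probability. -/
structure IsMarkovOfOrder (k : ℕ) (μ : Measure (ℤ → A)) : Prop where
  split : ∀ (z : ℕ → A) (a b : ℕ),
    windowProb μ z 0 (a + k + b) * windowProb μ z a (a + k) =
      windowProb μ z 0 (a + k) * windowProb μ z a (a + k + b)
  connected : ∀ z z' : ℕ → A, 0 < windowProb μ z 0 k → 0 < windowProb μ z' 0 k →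
    ∃ (N : ℕ) (y : ℕ → A), 1 ≤ N ∧ (∀ i < k, y i = z i) ∧ (∀ i < k, y (N + i) = z' i) ∧
      0 < windowProb μ y 0 (N + k)

variable [MeasurableSingletonClass A] {μ : Measure (ℤ → A)}

/-- The symbols outside the support of a `1`-step Markov measure are null. -/
lemma windowProb_eq_zero_of_notMem [Fintype A] [IsProbabilityMeasure μ] {s : Finset A}
    (hs : ∑ a ∈ s, windowProb μ (fun _ => a) 0 1 = 1) {a : A} (ha : a ∉ s) :
    windowProb μ (fun _ => a) 0 1 = 0 := by
  classical
  have h := sum_windowProb_update_right μ (fun _ => a) (le_refl 0)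
  rw [windowProb_self] at h
  have h' : ∑ c, windowProb μ (fun _ => c) 0 1 = 1 := by
    rw [← h]
    refine Finset.sum_congr rfl fun c _ => windowProb_congr μ fun i _ hi => ?_
    obtain rfl : i = 0 := by omega
    simp
  rw [← Finset.sum_add_sum_compl s, hs, add_eq_left,
    Finset.sum_eq_zero_iff_of_nonneg fun _ _ => windowProb_nonneg _ _ _ _] at h'
  exact h' a (by simpa using ha)

/-- By the product formula both sides of the splitting are the same product of transitions times `v
(z 0) * v (z a)`. -/
lemma IsOneStepMarkov.isMarkovOfOrder [Fintype A] (hinv : IsInvariant μ)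
    (h : IsOneStepMarkov μ) : IsMarkovOfOrder 1 μ := by
  classical
  obtain ⟨hprob, s, v, M, ⟨hM0, -⟩, hirr, ⟨hv0, hv1⟩, -, hw⟩ := h
  have hform : ∀ (z : ℕ → s) (n : ℕ), windowProb μ (fun i => (z i : A)) 0 (n + 1) =
      v (z 0) * ∏ i ∈ Finset.range n, M (z i) (z (i + 1)) := by
    intro z n
    have h1 := hw n fun i => z i
    rw [wordCylinder_eq_window _ (fun i => (z i : A)) fun j hj => by rw [List.getElem_ofFn],
      List.length_ofFn] at h1
    rw [windowProb, h1, Finset.prod_range]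
    simp
  have hletter : ∀ a : s, windowProb μ (fun _ => (a : A)) 0 1 = v a := fun a => by
    simpa using hform (fun _ => a) 0
  have hs : ∑ a ∈ s, windowProb μ (fun _ => a) 0 1 = 1 := by
    rw [← Finset.sum_coe_sort, ← hv1]
    exact Finset.sum_congr rfl fun a _ => hletter a
  have hmem : ∀ (z : ℕ → A) (i : ℕ), windowProb μ z i (i + 1) ≠ 0 → z i ∈ s := by
    intro z i hi
    by_contra hz
    refine hi ?_
    rw [← windowProb_eq_zero_of_notMem hs hz]
    refine hinv.windowProb_eq (by omega) fun j hj => ?_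
    obtain rfl : j = 0 := by omega
    simp
  have hform' : ∀ (z : ℕ → s) (a n : ℕ), windowProb μ (fun i => (z i : A)) a (a + (n + 1)) =
      v (z a) * ∏ i ∈ Finset.range n, M (z (a + i)) (z (a + i + 1)) := by
    intro z a n
    have h1 := hinv.windowProb_add (fun i => (z i : A)) 0 (n + 1) a
    rw [zero_add, add_comm (n + 1) a] at h1
    rw [← h1, hform (fun i => z (i + a))]
    simp only [add_comm _ a, add_assoc]
    rfl
  constructor
  · intro z a b
    by_cases hz : ∀ i < a + 1 + b, z i ∈ s
    · obtain ⟨y, hy⟩ : ∃ y : ℕ → s, ∀ i < a + 1 + b, (y i : A) = z i :=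
        ⟨fun i => if h : i < a + 1 + b then ⟨z i, hz i h⟩ else ⟨z 0, hz 0 (by omega)⟩,
          fun i hi => by simp [hi]⟩
      have hc : ∀ c d, d ≤ a + 1 + b →
          windowProb μ z c d = windowProb μ (fun i => (y i : A)) c d := fun c d hd =>
        windowProb_congr μ fun i _ hi => (hy i (hi.trans_le hd)).symm
      rw [hc 0 _ le_rfl, hc a _ le_rfl, hc 0 _ (by omega), hc a _ (by omega),
        hform y a, hform' y a 0, show a + 1 + b = a + b + 1 by ring, hform y (a + b), add_assoc a b,
        hform' y a b, Finset.prod_range_add]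
      simp only [Finset.range_zero, Finset.prod_empty]
      ring
    -- A letter outside `s` makes both sides vanish: it lies in the full window and in one factor on
    -- the right.
    · push Not at hz
      obtain ⟨i, hi, hzi⟩ := hz
      have h0 : ∀ c d, c ≤ i → i < d → windowProb μ z c d = 0 := fun c d hc hd =>
        le_antisymm ((windowProb_mono μ z hc (Nat.succ_le_of_lt hd)).trans
          (not_not.1 fun h => hzi (hmem z i h)).le) (windowProb_nonneg _ _ _ _)
      rw [h0 0 _ (Nat.zero_le _) hi, zero_mul]
      rcases le_or_gt a i with h | h
      · rw [h0 a _ h hi, mul_zero]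
      · rw [h0 0 (a + 1) (Nat.zero_le _) (by omega), zero_mul]
  · intro z z' hz hz'
    rw [Matrix.isIrreducible_iff_exists_pow_pos hM0] at hirr
    have hzs : z 0 ∈ s := hmem z 0 hz.ne'
    have hzs' : z' 0 ∈ s := hmem z' 0 hz'.ne'
    obtain ⟨N, hN, hpos⟩ := hirr ⟨z 0, hzs⟩ ⟨z' 0, hzs'⟩
    obtain ⟨y, hy0, hyN, hy⟩ := (pow_apply_pos_iff_exists_path hM0 _ _ _).1 hpos
    refine ⟨N, fun i => (y i : A), hN, fun i hi => ?_, fun i hi => ?_, ?_⟩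
    · obtain rfl : i = 0 := by omega
      simp [hy0]
    · obtain rfl : i = 0 := by omega
      simp [hyN]
    · rw [hform]
      refine mul_pos ?_ (Finset.prod_pos fun i hi => hy i (Finset.mem_range.1 hi))
      rw [← hletter, hy0]
      refine hz.trans_eq (windowProb_congr μ fun i _ hi => ?_)
      obtain rfl : i = 0 := by omega
      rfl

/-- The matrix is that of conditional probabilities `q a b / p a` on the letters of positive
probability. The right marginal of `q` makes it stochastic, the left one makes `p` stationary. -/
lemma IsMarkovOfOrder.isOneStepMarkov [Fintype A] [IsProbabilityMeasure μ] (hinv : IsInvariant μ)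
    (h : IsMarkovOfOrder 1 μ) : IsOneStepMarkov μ := by
  classical
  set p : A → ℝ := fun a => windowProb μ (fun _ => a) 0 1 with hp
  set q : A → A → ℝ := fun a b => windowProb μ (fun i => if i = 0 then a else b) 0 2 with hq
  have hp0 : ∀ a, 0 ≤ p a := fun a => windowProb_nonneg _ _ _ _
  have hq0 : ∀ a b, 0 ≤ q a b := fun a b => windowProb_nonneg _ _ _ _
  have hpw : ∀ (z : ℕ → A) (i : ℕ), windowProb μ z i (i + 1) = p (z i) := fun z i =>
    hinv.windowProb_eq (by omega) fun j hj => by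
      obtain rfl : j = 0 := by omega
      rfl
  have hqw : ∀ (z : ℕ → A) (i : ℕ), windowProb μ z i (i + 2) = q (z i) (z (i + 1)) := fun z i =>
    hinv.windowProb_eq (by omega) fun j hj => by
      obtain rfl | rfl : j = 0 ∨ j = 1 := by omega
      · simp
      · simp
  have hpsum : ∑ a, p a = 1 := by
    obtain ⟨x⟩ : Nonempty (ℤ → A) := μ.nonempty_of_neZero
    have h1 := sum_windowProb_update_right μ (fun _ => x 0) (le_refl 0)
    rw [windowProb_self] at h1
    rw [← h1]
    exact Finset.sum_congr rfl fun c _ => by rw [hpw]; simp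
  have hqright : ∀ a, ∑ b, q a b = p a := fun a => by
    have h1 := sum_windowProb_update_right μ (fun _ => a) (zero_le_one)
    change _ = p a at h1
    rw [← h1]
    exact Finset.sum_congr rfl fun c _ => ((hqw _ 0).trans (by simp)).symm
  have hqleft : ∀ b, ∑ a, q a b = p b := fun b => by
    have h1 := sum_windowProb_update_left μ (fun _ => b) (zero_lt_two)
    refine Eq.trans ?_ (h1.trans (hpw _ 1))
    exact Finset.sum_congr rfl fun c _ => ((hqw _ 0).trans (by simp)).symm
  have hql : ∀ {a b}, p a = 0 → q a b = 0 := fun {a b} ha => le_antisymm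
    (ha ▸ hqright a ▸ Finset.single_le_sum (fun c _ => hq0 a c) (Finset.mem_univ b)) (hq0 a b)
  have hqr : ∀ {a b}, p b = 0 → q a b = 0 := fun {a b} hb => le_antisymm
    (hb ▸ hqleft b ▸ Finset.single_le_sum (fun c _ => hq0 c b) (Finset.mem_univ a)) (hq0 a b)
  set s : Finset A := {a | p a ≠ 0} with hs
  have hmem : ∀ a, a ∈ s ↔ p a ≠ 0 := fun a => by simp [hs]
  have hsum : ∀ f : A → ℝ, (∀ a, p a = 0 → f a = 0) → ∑ a : s, f a = ∑ a, f a := by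
    intro f hf
    rw [Finset.sum_coe_sort s f]
    refine Finset.sum_subset (Finset.subset_univ _) fun a _ ha => hf a ?_
    simpa [hmem] using ha
  have hM0 : ∀ a b : s, 0 ≤ q a b / p a := fun a b => div_nonneg (hq0 _ _) (hp0 _)
  refine ⟨inferInstance, s, fun a => p a, Matrix.of fun a b => q a b / p a, ⟨hM0, fun a => ?_⟩, ?_,
    ⟨fun a => hp0 a, ?_⟩, ?_, ?_⟩
  · simp only [Matrix.of_apply]
    rw [← Finset.sum_div, hsum _ fun b hb => hqr hb, hqright, div_self ((hmem _).1 a.2)]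
  · refine (Matrix.isIrreducible_iff_exists_pow_pos hM0).2 fun a b => ?_
    have hpos : ∀ a : s, 0 < windowProb μ (fun _ => (a : A)) 0 1 := fun a =>
      (hp0 a).lt_of_ne' ((hmem _).1 a.2)
    obtain ⟨N, y, hN, hya, hyb, hy⟩ := h.connected (fun _ => a) (fun _ => b) (hpos a) (hpos b)
    have hyp : ∀ i ≤ N, 0 < p (y i) := fun i hi => by
      rw [← hpw]
      exact hy.trans_le (windowProb_mono μ y (Nat.zero_le _) (by omega))
    refine ⟨N, hN, (pow_apply_pos_iff_exists_path hM0 _ _ _).2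
      ⟨fun i => if hi : i ≤ N then ⟨y i, (hmem _).2 (hyp i hi).ne'⟩ else a, ?_, ?_, ?_⟩⟩
    · simp [hya 0 one_pos]
    · simpa [Subtype.ext_iff] using hyb 0 one_pos
    · intro t ht
      simp only [ht.le, Nat.succ_le_of_lt ht, dite_true]
      refine div_pos ?_ (hyp t ht.le)
      rw [← hqw]
      exact hy.trans_le (windowProb_mono μ y (Nat.zero_le _) (by omega))
  · rw [hsum p fun a ha => ha, hpsum]
  · ext b
    simp only [Matrix.vecMul, dotProduct, Matrix.of_apply]
    rw [Finset.sum_congr rfl fun (a : s) _ => mul_div_cancel₀ (q a b) ((hmem _).1 a.2),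
      hsum (fun a => q a b) fun a ha => hql ha, hqleft]
  · intro n w
    have hform : ∀ (z : ℕ → A) (m : ℕ), (∀ i ≤ m, p (z i) ≠ 0) → windowProb μ z 0 (m + 1) =
        p (z 0) * ∏ i ∈ Finset.range m, q (z i) (z (i + 1)) / p (z i) := by
      intro z m hz
      induction m with
      | zero => simp [hpw]
      | succ m ih =>
        -- Splitting at the single letter `z m` with a future of one letter multiplies the
        -- probability by one transition.
        have h1 := h.split z m 1
        rw [hpw, add_assoc m 1 1, hqw, ih fun i hi => hz i (by omega)] at h1
        rw [Finset.prod_range_succ, add_assoc m 1 1, ← mul_assoc, mul_div_assoc', ← h1,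
          mul_div_cancel_right₀ _ (hz m (by omega))]
    set z : ℕ → A := fun i => if hi : i < n + 1 then w ⟨i, hi⟩ else w 0 with hz
    have hzw : ∀ i (hi : i < n + 1), z i = w ⟨i, hi⟩ := fun i hi => dif_pos hi
    rw [wordCylinder_eq_window _ z fun j hj => by
      rw [List.getElem_ofFn, hzw j (by simpa using hj)], List.length_ofFn]
    refine (hform z n fun i hi => ?_).trans ?_
    · rw [hzw i (by omega)]
      exact (hmem _).1 (w _).2
    · rw [Finset.prod_range, hzw 0 (by omega)]
      congr 1
      refine Finset.prod_congr rfl fun i _ => ?_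
      rw [hzw _ (by omega), hzw _ (by omega)]
      rfl

end Markov


/-! ### Reduction of order `k` to order one by the higher block code. -/

section HigherBlock

variable {A : Type*}

/-- The one-sided sequence of the blocks of length `k` of `z`. -/
def blocks (k : ℕ) (z : ℕ → A) : ℕ → (Fin k → A) := fun i j => z (i + j)

lemma higherBlockCode_shift (k : ℕ) (x : ℤ → A) :
    higherBlockCode k (shift x) = shift (higherBlockCode k x) := by
  funext i j
  simp only [higherBlockCode, shift]
  congr 1
  ring

lemma iterate_shift_apply (n : ℕ) (x : ℤ → A) (i : ℤ) : shift^[n] x i = x (i + n) := by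
  induction n generalizing x with
  | zero => simp
  | succ n ih =>
    rw [Function.iterate_succ_apply, ih]
    simp only [shift, Nat.cast_add, Nat.cast_one, add_assoc]

/-- The code puts at `i` the block ending at `i`, while `blocks` uses the block starting at `i`; the
`m` shifts realign them. For `a = b` the left side would be everything, yet the right side could
still fix `m` letters. -/
lemma preimage_higherBlockCode_window (m : ℕ) (z : ℕ → A) {a b : ℕ} (hab : a < b) :
    shift^[m] ⁻¹' (higherBlockCode (m + 1) ⁻¹' window (blocks (m + 1) z) a b) =
      window z a (b + m) := by
  ext x
  simp only [window, Set.mem_preimage, Set.mem_ofPred_eq, funext_iff, higherBlockCode, blocks,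
    iterate_shift_apply]
  constructor
  · intro h t h1 h2
    rcases lt_or_ge t b with hb | hb
    · have := h t h1 hb 0
      simp only [Fin.val_zero, add_zero] at this
      rw [← this]
      congr 1
      push_cast
      ring
    · have := h (b - 1) (by omega) (by omega) ⟨t - (b - 1), by omega⟩
      simp only [show b - 1 + (t - (b - 1)) = t by omega] at this
      rw [← this]
      congr 1
      push_cast [show b - 1 ≤ t by omega, show 1 ≤ b by omega]
      ring
  · intro h i h1 h2 j
    rw [← h (i + j) (by omega) (by have := j.2; omega)]
    congr 1
    push_cast
    ring

variable [MeasurableSpace A]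

lemma measurable_shift : Measurable (shift : (ℤ → A) → ℤ → A) :=
  measurable_pi_lambda _ fun i => measurable_pi_apply (i + 1)

lemma measurable_higherBlockCode (k : ℕ) :
    Measurable (higherBlockCode k : (ℤ → A) → ℤ → Fin k → A) :=
  measurable_pi_lambda _ fun _ => measurable_pi_lambda _ fun _ => measurable_pi_apply _

variable {μ : Measure (ℤ → A)}

lemma IsInvariant.iterate (hinv : IsInvariant μ) (n : ℕ) {U : Set (ℤ → A)}
    (hU : MeasurableSet U) : μ (shift^[n] ⁻¹' U) = μ U := by
  induction n with
  | zero => rfl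
  | succ n ih =>
    rw [Function.iterate_succ, Set.preimage_comp, hinv _ ((measurable_shift.iterate n) hU), ih]

lemma IsInvariant.map_higherBlockCode (hinv : IsInvariant μ) (k : ℕ) :
    IsInvariant (μ.map (higherBlockCode k)) := by
  intro U hU
  rw [Measure.map_apply (measurable_higherBlockCode k) (measurable_shift hU),
    Measure.map_apply (measurable_higherBlockCode k) hU,
    ← hinv _ (measurable_higherBlockCode k hU)]
  congr 1
  ext x
  simp only [Set.mem_preimage, higherBlockCode_shift]

variable [MeasurableSingletonClass A]

lemma windowProb_map_blocks [Finite A] (hinv : IsInvariant μ) (m : ℕ) (z : ℕ → A) {a b : ℕ}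
    (hab : a < b) :
    windowProb (μ.map (higherBlockCode (m + 1))) (blocks (m + 1) z) a b =
      windowProb μ z a (b + m) := by
  have hU := measurableSet_window (blocks (m + 1) z) a b
  rw [windowProb, windowProb, map_measureReal_apply (measurable_higherBlockCode _) hU,
    ← preimage_higherBlockCode_window m z hab, measureReal_def, measureReal_def,
    hinv.iterate m (measurable_higherBlockCode _ hU)]

/-- A window of nonzero measure meets the image of the code, so its blocks overlap consistently. -/
lemma exists_eq_blocks [Finite A] (m : ℕ) {W : ℕ → Fin (m + 1) → A} {a b : ℕ}
    (hW : windowProb (μ.map (higherBlockCode (m + 1))) W a b ≠ 0) :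
    ∃ z : ℕ → A, ∀ i, a ≤ i → i < b → W i = blocks (m + 1) z i := by
  rw [windowProb, map_measureReal_apply (measurable_higherBlockCode _)
    (measurableSet_window W a b)] at hW
  obtain ⟨x, hx⟩ : (higherBlockCode (m + 1) ⁻¹' window W a b).Nonempty := by
    rw [Set.nonempty_iff_ne_empty]
    intro h
    simp [h] at hW
  refine ⟨fun t => x (t - m), fun i h1 h2 => ?_⟩
  rw [← hx i h1 h2]
  funext j
  simp only [higherBlockCode, blocks]
  congr 1
  push_cast
  ring

variable [IsProbabilityMeasure μ]

lemma isMarkovOfOrder_one_map_iff [Finite A] (hinv : IsInvariant μ) (m : ℕ) :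
    IsMarkovOfOrder 1 (μ.map (higherBlockCode (m + 1))) ↔ IsMarkovOfOrder (m + 1) μ := by
  set ν := μ.map (higherBlockCode (m + 1)) with hν
  have : IsProbabilityMeasure ν :=
    Measure.isProbabilityMeasure_map (measurable_higherBlockCode _).aemeasurable
  have hblock : ∀ (z : ℕ → A) (a b c : ℕ), a < b → c = b + m →
      windowProb ν (blocks (m + 1) z) a b = windowProb μ z a c := by
    rintro z a b _ hab rfl
    exact windowProb_map_blocks hinv m z hab
  constructor
  · intro h
    constructor
    · intro z a b
      have h1 := h.split (blocks (m + 1) z) a b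
      rwa [hblock z 0 (a + 1 + b) (a + (m + 1) + b) (by omega) (by omega),
        hblock z a (a + 1) (a + (m + 1)) (by omega) (by omega),
        hblock z 0 (a + 1) (a + (m + 1)) (by omega) (by omega),
        hblock z a (a + 1 + b) (a + (m + 1) + b) (by omega) (by omega)] at h1
    · intro z z' hz hz'
      rw [← hblock z 0 1 _ one_pos (by omega)] at hz
      rw [← hblock z' 0 1 _ one_pos (by omega)] at hz'
      obtain ⟨N, W, hN, hW0, hWN, hW⟩ := h.connected _ _ hz hz'
      obtain ⟨y, hy⟩ := exists_eq_blocks m hW.ne'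
      refine ⟨N, y, hN, fun i hi => ?_, fun i hi => ?_, ?_⟩
      · have h1 := congr_fun ((hy 0 (by omega) (by omega)).symm.trans (hW0 0 one_pos)) ⟨i, hi⟩
        simpa [blocks] using h1
      · have h1 := congr_fun ((hy N (by omega) (by omega)).symm.trans (hWN 0 one_pos)) ⟨i, hi⟩
        simpa [blocks] using h1
      · rw [← hblock y 0 (N + 1) _ (by omega) (by omega)]
        rwa [windowProb_congr ν fun i h1 h2 => hy i h1 h2] at hW
  · intro h
    constructor
    · intro W a b
      by_cases hW : windowProb ν W 0 (a + 1) ≠ 0 ∧ windowProb ν W a (a + 1 + b) ≠ 0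
      · obtain ⟨z₁, hz₁⟩ := exists_eq_blocks m hW.1
        obtain ⟨z₂, hz₂⟩ := exists_eq_blocks m hW.2
        -- Both sequences read the same block `W a` on `[a, a + m]`, so blocks straddling `a` are
        -- also correct for the glued sequence.
        set z : ℕ → A := fun t => if t < a then z₁ t else z₂ t with hz
        have hWz : ∀ i < a + 1 + b, W i = blocks (m + 1) z i := by
          intro i hi
          rcases lt_or_ge i a with hia | hia
          · rw [hz₁ i (Nat.zero_le _) (by omega)]
            funext j
            simp only [blocks, hz]
            split_ifs with hj
            · rfl
            · have e := congr_fun ((hz₁ a (Nat.zero_le _) (by omega)).symm.trans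
                (hz₂ a le_rfl (by omega))) ⟨i + j - a, by omega⟩
              simpa [blocks, show a + (i + j - a) = i + j by omega] using e
          · rw [hz₂ i hia hi]
            funext j
            simp [blocks, hz, show ¬ (i + (j : ℕ) < a) by omega]
        have hc : ∀ c d, d ≤ a + 1 + b →
            windowProb ν W c d = windowProb ν (blocks (m + 1) z) c d := fun c d hd =>
          windowProb_congr ν fun i _ hi => hWz i (hi.trans_le hd)
        rw [hc 0 _ le_rfl, hc a _ le_rfl, hc 0 _ (by omega), hc a _ (by omega),
          hblock z 0 (a + 1 + b) (a + (m + 1) + b) (by omega) (by omega),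
          hblock z a (a + 1) (a + (m + 1)) (by omega) (by omega),
          hblock z 0 (a + 1) (a + (m + 1)) (by omega) (by omega),
          hblock z a (a + 1 + b) (a + (m + 1) + b) (by omega) (by omega)]
        exact h.split z a b
      -- Here a factor on the right is zero, and either factor bounds the probability of the full
      -- window.
      · have h0 : windowProb ν W 0 (a + 1 + b) = 0 := by
          refine le_antisymm ?_ (windowProb_nonneg _ _ _ _)
          rw [not_and_or, not_not, not_not] at hW
          rcases hW with hW | hW
          · exact hW ▸ windowProb_mono ν W le_rfl (by omega)
          · exact hW ▸ windowProb_mono ν W (Nat.zero_le _) le_rfl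
        rw [h0, zero_mul, eq_comm, mul_eq_zero]
        by_contra! hW'
        exact hW hW'
    · intro W W' hW hW'
      obtain ⟨z, hz⟩ := exists_eq_blocks m hW.ne'
      obtain ⟨z', hz'⟩ := exists_eq_blocks m hW'.ne'
      rw [windowProb_congr ν hz, hblock z 0 1 _ one_pos (Nat.add_comm m 1)] at hW
      rw [windowProb_congr ν hz', hblock z' 0 1 _ one_pos (Nat.add_comm m 1)] at hW'
      obtain ⟨N, y, hN, hy0, hyN, hy⟩ := h.connected z z' hW hW'
      refine ⟨N, blocks (m + 1) y, hN, fun i hi => ?_, fun i hi => ?_, ?_⟩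
      · obtain rfl : i = 0 := by omega
        rw [hz 0 le_rfl one_pos]
        funext j
        simpa [blocks] using hy0 j j.2
      · obtain rfl : i = 0 := by omega
        rw [hz' 0 le_rfl one_pos]
        funext j
        simpa [blocks] using hyN j j.2
      · rwa [hblock y 0 (N + 1) (N + (m + 1)) (by omega) (by omega)]

lemma isStepMarkov_iff [Fintype A] (hinv : IsInvariant μ) {k : ℕ} (hk : 1 ≤ k) :
    IsStepMarkov k μ ↔ IsMarkovOfOrder k μ := by
  classical
  obtain ⟨m, rfl⟩ : ∃ m, k = m + 1 := ⟨k - 1, by omega⟩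
  have : IsProbabilityMeasure (μ.map (higherBlockCode (m + 1))) :=
    Measure.isProbabilityMeasure_map (measurable_higherBlockCode _).aemeasurable
  rw [← isMarkovOfOrder_one_map_iff hinv, IsStepMarkov]
  exact ⟨fun h => h.isMarkovOfOrder (hinv.map_higherBlockCode _),
    fun h => h.isOneStepMarkov (hinv.map_higherBlockCode _)⟩

end HigherBlock

/-! ### Transfer of connectedness between orders. -/

section Connected

variable {A : Type*} [MeasurableSpace A] [MeasurableSingletonClass A] [Fintype A]
  {μ : Measure (ℤ → A)} [IsProbabilityMeasure μ]

lemma exists_extension_right (z : ℕ → A) {b : ℕ} (c : ℕ) (hz : 0 < windowProb μ z 0 b) :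
    ∃ y : ℕ → A, (∀ i < b, y i = z i) ∧ 0 < windowProb μ y 0 (b + c) := by
  induction c with
  | zero => exact ⟨z, fun _ _ => rfl, hz⟩
  | succ c ih =>
    obtain ⟨y, hy, hpos⟩ := ih
    rw [← sum_windowProb_update_right μ y (Nat.zero_le _)] at hpos
    obtain ⟨l, -, hl⟩ := Finset.exists_lt_of_sum_lt (f := fun _ => (0 : ℝ)) (by simpa using hpos)
    exact ⟨_, fun i hi => (Function.update_of_ne (by omega) _ _).trans (hy i hi), hl⟩

lemma exists_extension_left (hinv : IsInvariant μ) (z : ℕ → A) {b : ℕ} (c : ℕ)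
    (hz : 0 < windowProb μ z 0 b) :
    ∃ y : ℕ → A, (∀ i < b, y (c + i) = z i) ∧ 0 < windowProb μ y 0 (c + b) := by
  induction c with
  | zero => exact ⟨z, fun _ _ => by rw [zero_add], by rwa [zero_add]⟩
  | succ c ih =>
    obtain ⟨y, hy, hpos⟩ := ih
    -- Moving the window right by one frees position `0` for a new letter; the truncated value of `i
    -- - 1` there is overwritten.
    rw [hinv.windowProb_eq (z' := fun i => y (i - 1)) (a' := 0 + 1) (b' := c + 1 + b) (by omega)
      fun i _ => by simp [add_comm 1 i],
      ← sum_windowProb_update_left μ _ (by omega)] at hpos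
    obtain ⟨l, -, hl⟩ := Finset.exists_lt_of_sum_lt (f := fun _ => (0 : ℝ)) (by simpa using hpos)
    refine ⟨_, fun i hi => (Function.update_of_ne (by omega) _ _).trans ?_, hl⟩
    rw [← hy i hi]
    congr 1
    omega

/-- Extend `z` to the right and `z'` to the left by `k` letters, join the two added words using
order `k`, and glue along them by splitting at order `k`. No comparison of `k` with `K` is needed.
-/
lemma IsMarkovOfOrder.of_split (hinv : IsInvariant μ) {k K : ℕ} (h : IsMarkovOfOrder k μ)
    (hK : ∀ (z : ℕ → A) (a b : ℕ),
      windowProb μ z 0 (a + K + b) * windowProb μ z a (a + K) =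
        windowProb μ z 0 (a + K) * windowProb μ z a (a + K + b)) :
    IsMarkovOfOrder K μ := by
  refine ⟨hK, fun z z' hz hz' => ?_⟩
  obtain ⟨y₁, hy₁, hp₁⟩ := exists_extension_right z k hz
  obtain ⟨y₂, hy₂, hp₂⟩ := exists_extension_left hinv z' k hz'
  have hq₁ : 0 < windowProb μ (fun i => y₁ (K + i)) 0 k := by
    rw [hinv.windowProb_eq (z' := y₁) (a' := K) (b' := K + k) (by omega) fun i _ => by simp]
    exact hp₁.trans_le (windowProb_mono μ _ (Nat.zero_le _) le_rfl)
  obtain ⟨N, y₃, hN, hy₃, hy₃', hp₃⟩ := h.connected (fun i => y₁ (K + i)) y₂ hq₁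
    (hp₂.trans_le (windowProb_mono μ _ le_rfl (by omega)))
  -- The pieces `y₁`, `y₃`, `y₂` start at `0`, `K`, `K + N`; consecutive ones share a block of
  -- length `k`.
  set y : ℕ → A := fun t =>
    if t < K then y₁ t else if t < K + N then y₃ (t - K) else y₂ (t - (K + N)) with hy
  have e₃ : ∀ i < N + k, y (K + i) = y₃ i := by
    intro i hi
    rcases lt_or_ge i N with hiN | hiN
    · simp [hy, hiN]
    · have := hy₃' (i - N) (by omega)
      rw [show N + (i - N) = i by omega] at this
      simp [hy, show ¬ (i < N) by omega, this, Nat.add_sub_add_left]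
  have e₁ : ∀ i < K + k, y i = y₁ i := by
    intro i hi
    rcases lt_or_ge i K with hiK | hiK
    · simp [hy, hiK]
    · obtain ⟨j, rfl⟩ := Nat.exists_eq_add_of_le hiK
      rw [e₃ j (by omega), hy₃ j (by omega)]
  have e₂ : ∀ i, y (K + N + i) = y₂ i := by
    intro i
    simp [hy, show ¬ (K + N + i < K) by omega]
  have p₁ : 0 < windowProb μ y 0 (K + k) := by
    rwa [windowProb_congr μ fun i _ hi => e₁ i hi]
  have p₃ : 0 < windowProb μ y K (K + k + N) := by
    rwa [hinv.windowProb_eq (z' := y₃) (a' := 0) (b' := N + k) (by omega) fun i hi => by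
      rw [zero_add, e₃ i (by omega)]]
  have p₂ : 0 < windowProb μ y (K + N) (K + N + k + K) := by
    rwa [hinv.windowProb_eq (z' := y₂) (a' := 0) (b' := k + K) (by omega) fun i _ => by
      rw [zero_add, e₂ i]]
  have p₁₃ : 0 < windowProb μ y 0 (K + N + k) := by
    rw [show K + N + k = K + k + N by omega]
    -- The right side of the splitting is positive, hence so is the probability of the glued window
    -- on the left.
    have := h.split y K N ▸ mul_pos p₁ p₃
    exact pos_of_mul_pos_left this (windowProb_nonneg _ _ _ _)
  have p : 0 < windowProb μ y 0 (K + N + k + K) := by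
    have := h.split y (K + N) K ▸ mul_pos p₁₃ p₂
    exact pos_of_mul_pos_left this (windowProb_nonneg _ _ _ _)
  refine ⟨K + N + k, y, by omega, fun i hi => ?_, fun i hi => ?_, p⟩
  · rw [e₁ i (by omega), hy₁ i hi]
  · rw [add_assoc (K + N), e₂, hy₂ i hi]

end Connected


/-! ### Translation between words and windows. -/

section Words

variable {A : Type*} [MeasurableSpace A] [MeasurableSingletonClass A] {μ : Measure (ℤ → A)}

lemma IsInvariant.measureReal_wordCylinder (hinv : IsInvariant μ) (l : List A) (z : ℕ → A)
    (a c : ℕ) (hc : c = a + l.length) (h : ∀ (j : ℕ) (hj : j < l.length), z (a + j) = l[j]) :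
    μ.real (wordCylinder l) = windowProb μ z a c := by
  subst hc
  rw [wordCylinder_eq_window l (fun j => z (a + j)) h]
  exact hinv.windowProb_eq (by omega) fun i _ => by simp

lemma IsInvariant.exists_windowProb_eq [Nonempty A] (hinv : IsInvariant μ) (w u v : List A) :
    ∃ z : ℕ → A,
      μ.real (wordCylinder (w ++ u ++ v)) =
        windowProb μ z 0 (w.length + u.length + v.length) ∧
      μ.real (wordCylinder u) = windowProb μ z w.length (w.length + u.length) ∧
      μ.real (wordCylinder (w ++ u)) = windowProb μ z 0 (w.length + u.length) ∧
      μ.real (wordCylinder (u ++ v)) =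
        windowProb μ z w.length (w.length + u.length + v.length) := by
  obtain ⟨c⟩ := ‹Nonempty A›
  refine ⟨fun i => (w ++ u ++ v).getD i c, ?_, ?_, ?_, ?_⟩ <;>
    refine hinv.measureReal_wordCylinder _ _ _ _ (by simp [add_assoc]) fun j hj => ?_ <;>
    rw [List.getD_eq_getElem _ _ (by grind)] <;> grind

lemma IsInvariant.exists_measureReal_wordCylinder_eq (hinv : IsInvariant μ) (z : ℕ → A)
    (a k b : ℕ) :
    ∃ w u v : List A, u.length = k ∧
      μ.real (wordCylinder (w ++ u ++ v)) = windowProb μ z 0 (a + k + b) ∧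
      μ.real (wordCylinder u) = windowProb μ z a (a + k) ∧
      μ.real (wordCylinder (w ++ u)) = windowProb μ z 0 (a + k) ∧
      μ.real (wordCylinder (u ++ v)) = windowProb μ z a (a + k + b) := by
  refine ⟨(List.range a).map z, (List.range k).map fun i => z (a + i),
    (List.range b).map fun i => z (a + k + i), by simp, ?_, ?_, ?_, ?_⟩ <;>
    refine hinv.measureReal_wordCylinder _ _ _ _ (by simp [add_assoc]) fun j hj => ?_ <;>
    grind

end Words

/-! ### A dimension bound on the length needed to kill an invariant subspace. -/

section Nilpotent

variable {A V : Type*} [AddCommGroup V] [Module ℝ V]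

/-- The iterates decrease. Each strict step costs a dimension, and once two consecutive iterates
agree the chain is constant, so it is already `⊥`, its value at step `k`. -/
lemma iterate_eq_bot_of_finrank_le [FiniteDimensional ℝ V] {F : Submodule ℝ V → Submodule ℝ V}
    (hF : Monotone F) {S : Submodule ℝ V} (hS : F S ≤ S) {k : ℕ} (hk : F^[k] S = ⊥) {N : ℕ}
    (hN : Module.finrank ℝ V ≤ N) : F^[N] S = ⊥ := by
  have hanti : Antitone fun j => F^[j] S := hF.antitone_iterate_of_map_le hS
  have key : ∀ j, F^[j] S = ⊥ ∨ Module.finrank ℝ (F^[j] S) + j ≤ Module.finrank ℝ V := by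
    intro j
    induction j with
    | zero => exact Or.inr (Submodule.finrank_le _)
    | succ j ih =>
      have hle : F^[j + 1] S ≤ F^[j] S := hanti j.le_succ
      rcases ih with h | h
      · exact Or.inl (le_bot_iff.1 (h ▸ hle))
      rcases hle.lt_or_eq with hlt | heq
      · have := Submodule.finrank_lt_finrank_of_lt hlt
        exact Or.inr (by omega)
      · left
        have hfix : ∀ i, F^[i] (F^[j] S) = F^[j] S := fun i =>
          Function.iterate_fixed (by rwa [Function.iterate_succ_apply'] at heq) i
        rw [heq, ← hfix k, ← Function.iterate_add_apply]
        exact le_bot_iff.1 (hk ▸ hanti (Nat.le_add_right k j))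
  rcases key N with h | h
  · exact h
  · exact Submodule.finrank_eq_zero.1 (by omega)

/-- If a representation of a free monoid kills an invariant subspace under all words of some
length, then it does so under all words of length at least the dimension. -/
lemma apply_eq_zero_of_finrank_le_length [FiniteDimensional ℝ V]
    (T : FreeMonoid A →* Module.End ℝ V) {S : Submodule ℝ V} (hS : ∀ u, ∀ x ∈ S, T u x ∈ S)
    {k : ℕ} (hk : ∀ u : FreeMonoid A, u.length = k → ∀ x ∈ S, T u x = 0) {u : FreeMonoid A}
    (hu : Module.finrank ℝ V ≤ u.length) {x : V} (hx : x ∈ S) : T u x = 0 := by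
  -- `F^[j] S` is generated by the images of `S` under the words of length `j`.
  set F : Submodule ℝ V → Submodule ℝ V := fun p => ⨆ a, p.map (T (FreeMonoid.of a)) with hF
  have hmono : Monotone F := fun p q hpq => iSup_mono fun a => Submodule.map_mono hpq
  have hFS : F S ≤ S := iSup_le fun a => Submodule.map_le_iff_le_comap.2 (hS _)
  have hker : ∀ j, ∀ x ∈ F^[j] S, ∀ u : FreeMonoid A, u.length + j = k → T u x = 0 := by
    intro j
    induction j with
    | zero => exact fun x hx u hu => hk u hu x hx
    | succ j ih =>
      intro x hx u hu
      rw [Function.iterate_succ_apply'] at hx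
      refine (iSup_le fun a => Submodule.map_le_iff_le_comap.2 fun y hy => ?_ :
        F (F^[j] S) ≤ LinearMap.ker (T u)) hx
      rw [Submodule.mem_comap, LinearMap.mem_ker, ← Module.End.mul_apply, ← map_mul]
      exact ih y hy _ (by rw [FreeMonoid.length_mul, FreeMonoid.length_of]; omega)
  have hbot : F^[k] S = ⊥ := (Submodule.eq_bot_iff _).2 fun x hx => by
    simpa using hker k x hx 1 (by simp)
  have hmem : ∀ u : FreeMonoid A, T u x ∈ F^[u.length] S := by
    intro u
    induction u using FreeMonoid.inductionOn' with
    | one => simpa using hx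
    | of_mul a u ih =>
      rw [FreeMonoid.length_mul, FreeMonoid.length_of, add_comm, Function.iterate_succ_apply',
        map_mul, Module.End.mul_apply]
      exact Submodule.mem_iSup_of_mem a (Submodule.mem_map_of_mem ih)
  have := hmem u
  rwa [iterate_eq_bot_of_finrank_le hmono hFS hbot hu, Submodule.mem_bot] at this

end Nilpotent

/-! ### Rank at most one through skew-symmetric matrices. -/

section SkewSymmetric

variable {A : Type*} {n : ℕ}

open Matrix

/-- The congruence action of a matrix representation: `u ↦ (X ↦ φ(u) X φ(u)ᵀ)`. -/
def congruenceAction (φ : FreeMonoid A →* Matrix (Fin n) (Fin n) ℝ) :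
    FreeMonoid A →* Module.End ℝ (Matrix (Fin n) (Fin n) ℝ) where
  toFun u := LinearMap.mulRight ℝ (φ u)ᵀ ∘ₗ LinearMap.mulLeft ℝ (φ u)
  map_one' := by
    ext1 X
    simp
  map_mul' u v := by
    ext1 X
    simp [Matrix.transpose_mul, Matrix.mul_assoc]

/-- The matrices `P` with `P X Pᵀ = 0` for all skew-symmetric `X`, that is, those of rank at
most `1`. -/
def AnnihilatesSkew (P : Matrix (Fin n) (Fin n) ℝ) : Prop :=
  ∀ X : Matrix (Fin n) (Fin n) ℝ, Xᵀ = -X → P * X * Pᵀ = 0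

/-- The product is `(yᵀ X y) x xᵀ`, and a skew-symmetric form vanishes on the diagonal. -/
lemma annihilatesSkew_vecMulVec (x y : Fin n → ℝ) : AnnihilatesSkew (vecMulVec x y) := by
  intro X hX
  have h : y ⬝ᵥ X *ᵥ y = 0 := by
    have h1 : y ⬝ᵥ X *ᵥ y = y ⬝ᵥ Xᵀ *ᵥ y := by
      rw [dotProduct_mulVec, ← mulVec_transpose, dotProduct_comm]
    rw [hX, neg_mulVec, dotProduct_neg] at h1
    linarith
  rw [transpose_vecMulVec, vecMulVec_mul, vecMulVec_mul_vecMulVec, ← dotProduct_mulVec, h]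
  simp

/-- Testing on `X = x yᵀ - y xᵀ` shows that `P x` and `P y` are parallel; the identity is a
vanishing `2 × 2` minor. -/
lemma AnnihilatesSkew.dotProduct_mul_dotProduct {P : Matrix (Fin n) (Fin n) ℝ}
    (hP : AnnihilatesSkew P) (α β x y : Fin n → ℝ) :
    (α ⬝ᵥ P *ᵥ x) * (β ⬝ᵥ P *ᵥ y) = (α ⬝ᵥ P *ᵥ y) * (β ⬝ᵥ P *ᵥ x) := by
  have h := hP (vecMulVec x y - vecMulVec y x) (by simp [transpose_vecMulVec])
  rw [mul_sub, sub_mul, mul_vecMulVec, mul_vecMulVec, vecMulVec_mul, vecMulVec_mul,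
    vecMul_transpose, vecMul_transpose, sub_eq_zero] at h
  have h' := congr_arg (fun Q : Matrix (Fin n) (Fin n) ℝ => α ⬝ᵥ Q *ᵥ β) h
  simp only [vecMulVec_mulVec, dotProduct_smul, op_smul_eq_smul, smul_eq_mul] at h'
  rw [dotProduct_comm β, dotProduct_comm β]
  linarith

/-- Congruence preserves skew-symmetry, so the nilpotency bound applies; `n ^ 2` is the dimension of
the whole matrix space. -/
lemma annihilatesSkew_of_sq_le_length {φ : FreeMonoid A →* Matrix (Fin n) (Fin n) ℝ} {k : ℕ}
    (hk : ∀ u : FreeMonoid A, u.length = k → AnnihilatesSkew (φ u)) {u : FreeMonoid A}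
    (hu : n ^ 2 ≤ u.length) : AnnihilatesSkew (φ u) := by
  intro X hX
  set S : Submodule ℝ (Matrix (Fin n) (Fin n) ℝ) :=
    { carrier := {X | Xᵀ = -X}
      add_mem' := fun {X Y} hX hY => by
        simp only [Set.mem_ofPred_eq] at hX hY ⊢
        rw [transpose_add, hX, hY, neg_add]
      zero_mem' := by simp
      smul_mem' := fun c X hX => by
        simp only [Set.mem_ofPred_eq] at hX ⊢
        rw [transpose_smul, hX, smul_neg] } with hS
  have hmem : ∀ Y, Y ∈ S ↔ Yᵀ = -Y := fun Y => Iff.rfl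
  refine apply_eq_zero_of_finrank_le_length (congruenceAction φ) (S := S) (fun u Y hY => ?_)
    (k := k) (fun u hu Y hY => hk u hu Y hY) (u := u) ?_ hX
  · rw [hmem] at hY ⊢
    simp [congruenceAction, Matrix.mul_assoc, hY]
  · simpa [Module.finrank_matrix, sq] using hu

end SkewSymmetric

/-! ### Splitting at a word versus the rank of its matrix. -/

namespace LinearRepresentation

open Matrix

variable {A : Type*} {n : ℕ} {R : LinearRepresentation A n}

lemma series_mul_mul (w u v : FreeMonoid A) :
    R.series (w * u * v) = (R.row ᵥ* R.mor w) ⬝ᵥ R.mor u *ᵥ (R.mor v *ᵥ R.col) := by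
  simp only [series, map_mul, dotProduct_mulVec, vecMul_vecMul]

lemma IsReduced.ext (hR : R.IsReduced) {P Q : Matrix (Fin n) (Fin n) ℝ}
    (h : ∀ w v, (R.row ᵥ* R.mor w) ⬝ᵥ P *ᵥ (R.mor v *ᵥ R.col) =
      (R.row ᵥ* R.mor w) ⬝ᵥ Q *ᵥ (R.mor v *ᵥ R.col)) : P = Q := by
  have h1 : ∀ v, P *ᵥ (R.mor v *ᵥ R.col) = Q *ᵥ (R.mor v *ᵥ R.col) := by
    intro v
    refine dotProduct_eq _ _ fun x => ?_
    have hx : x ∈ Submodule.span ℝ (Set.range fun w => R.row ᵥ* R.mor w) := hR.1 ▸ trivial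
    rw [dotProduct_comm, dotProduct_comm _ x]
    induction hx using Submodule.span_induction with
    | mem x hx =>
      obtain ⟨w, rfl⟩ := hx
      exact h w v
    | zero => simp
    | add x y _ _ hx hy => rw [add_dotProduct, add_dotProduct, hx, hy]
    | smul c x _ hx => rw [smul_dotProduct, smul_dotProduct, hx]
  refine Matrix.mulVec_injective (funext fun x => ?_)
  have hx : x ∈ Submodule.span ℝ (Set.range fun v => R.mor v *ᵥ R.col) := hR.2 ▸ trivial
  induction hx using Submodule.span_induction with
  | mem x hx =>
    obtain ⟨v, rfl⟩ := hx
    exact h1 v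
  | zero => simp
  | add x y _ _ hx hy => rw [mulVec_add, mulVec_add, hx, hy]
  | smul c x _ hx => rw [mulVec_smul, mulVec_smul, hx]

variable [MeasurableSpace A] [MeasurableSingletonClass A] {μ : Measure (ℤ → A)}

lemma Represents.annihilatesSkew [IsProbabilityMeasure μ] [Nonempty A] (hRμ : R.Represents μ) (hR : R.IsReduced)
    (hinv : IsInvariant μ) {k : ℕ} (h : IsMarkovOfOrder k μ) {u : FreeMonoid A}
    (hu : u.length = k) : AnnihilatesSkew (R.mor u) := by
  subst hu
  -- Splitting reads `μ(wuv) = μ(wu) μ(uv) / μ(u)`, which factors `φ(u)` as a column times a row. If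
  -- `μ(u) = 0`, the inverse is `0` and `μ(wuv) ≤ μ(u)` vanishes too.
  have hP : R.mor u =
      vecMulVec ((R.series u)⁻¹ • (R.mor u *ᵥ R.col)) (R.row ᵥ* R.mor u) := by
    refine hR.ext fun w v => ?_
    rw [vecMulVec_mulVec, op_smul_eq_smul, smul_smul, dotProduct_smul, smul_eq_mul]
    have e1 := series_mul_mul (R := R) w u v
    have e2 : R.series (w * u) = (R.row ᵥ* R.mor w) ⬝ᵥ (R.mor u *ᵥ R.col) := by
      simpa using series_mul_mul (R := R) w u 1
    have e3 : R.series (u * v) = (R.row ᵥ* R.mor u) ⬝ᵥ (R.mor v *ᵥ R.col) := by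
      simpa [dotProduct_mulVec] using series_mul_mul (R := R) 1 u v
    rw [← e1, ← e2, ← e3]
    obtain ⟨z, h1, h2, h3, h4⟩ := hinv.exists_windowProb_eq w.toList u.toList v.toList
    rw [hRμ, hRμ, hRμ, hRμ]
    simp only [FreeMonoid.toList_mul, h1, h2, h3, h4]
    have hs := h.split z w.toList.length v.toList.length
    change windowProb μ z 0 (w.toList.length + u.toList.length + v.toList.length) *
      windowProb μ z w.toList.length (w.toList.length + u.toList.length) =
      windowProb μ z 0 (w.toList.length + u.toList.length) *
      windowProb μ z w.toList.length (w.toList.length + u.toList.length + v.toList.length) at hs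
    by_cases h0 : windowProb μ z w.toList.length (w.toList.length + u.toList.length) = 0
    · have : windowProb μ z 0 (w.toList.length + u.toList.length + v.toList.length) = 0 :=
        le_antisymm (h0 ▸ windowProb_mono μ z (Nat.zero_le _) (Nat.le_add_right _ _))
          (windowProb_nonneg _ _ _ _)
      rw [this, h0]
      simp
    · field_simp
      linarith
  rw [hP]
  exact annihilatesSkew_vecMulVec _ _

lemma Represents.split_of_annihilatesSkew (hRμ : R.Represents μ) (hinv : IsInvariant μ) {K : ℕ}
    (h : ∀ u : FreeMonoid A, u.length = K → AnnihilatesSkew (R.mor u)) (z : ℕ → A) (a b : ℕ) :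
    windowProb μ z 0 (a + K + b) * windowProb μ z a (a + K) =
      windowProb μ z 0 (a + K) * windowProb μ z a (a + K + b) := by
  obtain ⟨w, u, v, hu, h1, h2, h3, h4⟩ := hinv.exists_measureReal_wordCylinder_eq z a K b
  have hR : ∀ l : List A, μ.real (wordCylinder l) = R.series (FreeMonoid.ofList l) := fun l =>
    (hRμ (FreeMonoid.ofList l)).symm
  -- The rows for `w` and the empty word, against the columns for `v` and the empty word, give the
  -- four probabilities.
  have key := (h (FreeMonoid.ofList u) hu).dotProduct_mul_dotProduct
    (R.row ᵥ* R.mor (FreeMonoid.ofList w)) R.row (R.mor (FreeMonoid.ofList v) *ᵥ R.col) R.col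
  have e1 := series_mul_mul (R := R) (FreeMonoid.ofList w) (FreeMonoid.ofList u)
    (FreeMonoid.ofList v)
  have e2 := series_mul_mul (R := R) (FreeMonoid.ofList w) (FreeMonoid.ofList u) 1
  have e3 := series_mul_mul (R := R) 1 (FreeMonoid.ofList u) (FreeMonoid.ofList v)
  have e4 := series_mul_mul (R := R) 1 (FreeMonoid.ofList u) 1
  simp only [map_one, vecMul_one, one_mulVec, mul_one, one_mul] at e2 e3 e4
  rw [← e1, ← e2, ← e3, ← e4] at key
  rw [← h1, ← h2, ← h3, ← h4]
  simpa only [hR, FreeMonoid.ofList_append] using key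

end LinearRepresentation

end SymbolicDynamics

/-- An invariant sofic measure whose minimal linear representation has dimension `n` and which
is not `2 ^ (n ^ 2 - 1)`-step Markov is not `k`-step Markov for any `k ≥ 1`. -/
theorem mainTheorem1 {A : Type*} [Fintype A] [TopologicalSpace A] [DiscreteTopology A]
    [MeasurableSpace A] [MeasurableSingletonClass A]
    (Y : Set (ℤ → A)) (hY : SymbolicDynamics.IsShiftSpace Y)
    (μ : MeasureTheory.Measure (ℤ → A))
    (hμY : SymbolicDynamics.IsProbabilityMeasureOn Y μ)
    (hinv : SymbolicDynamics.IsInvariant μ)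
    (hsofic : SymbolicDynamics.IsSofic Y μ)
    (n : ℕ) (R : SymbolicDynamics.LinearRepresentation A n)
    (hRμ : R.Represents μ) (hred : R.IsReduced)
    (hK : ¬ SymbolicDynamics.IsStepMarkov (2 ^ (n ^ 2 - 1)) μ) :
    ∀ k : ℕ, 1 ≤ k → ¬ SymbolicDynamics.IsStepMarkov k μ := by
  intro k hk hmarkov
  have := hμY.isProbabilityMeasure
  have : Nonempty A := by
    obtain ⟨x⟩ : Nonempty (ℤ → A) := μ.nonempty_of_neZero
    exact ⟨x 0⟩
  refine hK ?_
  rw [SymbolicDynamics.isStepMarkov_iff hinv hk] at hmarkov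
  rw [SymbolicDynamics.isStepMarkov_iff hinv Nat.one_le_two_pow]
  refine hmarkov.of_split hinv (hRμ.split_of_annihilatesSkew hinv fun u hu => ?_)
  refine SymbolicDynamics.annihilatesSkew_of_sq_le_length
    (fun u hu => hRμ.annihilatesSkew hred hinv hmarkov hu) ?_
  -- This yields `n ^ 2 ≤ 2 ^ (n ^ 2 - 1)`, also for `n = 0`, where the subtraction truncates.
  have : n ^ 2 - 1 < 2 ^ (n ^ 2 - 1) := Nat.lt_two_pow_self
  omega
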